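/- Let $H$ be a quaternionic Hilbert space, that is, a right vector space over the quaternions $\mathbb{H}$ with an $\mathbb{H}$-valued inner product $\langle\cdot,\cdot\rangle$ (conjugate-linear in the first, right-linear in the second variable, with $\langle y,x\rangle=\overline{\langle x,y\rangle}$) which is complete for the norm $\|x\|=\langle x,x\rangle^{1/2}$. For a continuous right-linear operator $T$ on $H$ let $$\mu_n(T)=\inf\{\|T-F\| : F \text{ continuous right-linear on } H,\ \operatorname{rank}F<n\},\qquad n\ge 1,$$ be its singular values. For $1\le p<\infty$ the Schatten class $S_p$ consists of the compact $T$ with $\sum_n\mu_n(T)^p<\infty$, and $\|T\|_p=\big(\sum_{n}\mu_n(T)^p\big)^{1/p}$. A standard eigenvalue of $T$ is a $\lambda\in\mathbb{C}\subset\mathbb{H}$ with $\operatorname{Im}\lambda\ge 0$ such that $Tv=v\lambda$ for some $v\ne 0$; its multiplicity is the dimension over $\mathbb{H}$ of the right subspace spanned by its generalized eigenvectors, i.e. by the $v\in H$ annihilated by some power of the map $w\mapsto Tw-w\lambda$. Theorem. Let $1\le p<\infty$ and $T\in S_p$. Then the nonzero standard eigenvalues of $T$, each repeated according to its multiplicity,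 can be arranged in a sequence $\{\lambda_k\}_{k\ge1}$ (filled up with zeros where necessary), and every such sequence lies in $\ell^p$ and satisfies $$\|\{\lambda_k\}\|_{\ell^p}=\Big(\sum_{k}|\lambda_k|^p\Big)^{1/p}\le\|T\|_p .$$ -/

import Mathlib

open MulOpposite

noncomputable section

/-- A quaternionic inner product on a right quaternionic vector space `E`, inducing the norm of `E`.
The right action `x q` of a quaternion `q` is the action of `op q`, i.e. `op q • x`.
The inner product is conjugate-linear in the first and right-linear in the second argument.
A quaternionic Hilbert space is such a space which is moreover complete. -/
class QuaternionicInnerProductSpace (E : Type*) [NormedAddCommGroup E]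
    [Module (Quaternion ℝ)ᵐᵒᵖ E] extends Inner (Quaternion ℝ) E where
  star_inner : ∀ x y : E, star (inner y x) = inner x y
  inner_add_right : ∀ x y z : E, inner x (y + z) = inner x y + inner x z
  inner_smul_right : ∀ (x y : E) (q : Quaternion ℝ), inner x (op q • y) = inner x y * q
  norm_sq_eq_inner : ∀ x : E, ((‖x‖ ^ 2 : ℝ) : Quaternion ℝ) = inner x x

namespace QuaternionicOperator

variable {E : Type*} [NormedAddCommGroup E] [Module (Quaternion ℝ)ᵐᵒᵖ E]

/-- The operator norm of a continuous right-linear operator. -/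
def opNorm (T : E →L[(Quaternion ℝ)ᵐᵒᵖ] E) : ℝ :=
  sInf {c : ℝ | 0 ≤ c ∧ ∀ x : E, ‖T x‖ ≤ c * ‖x‖}

/-- The singular values of `T`, numbered from `0`: the entry with index `n` is the distance, in the
operator norm, from `T` to the continuous right-linear operators of quaternionic rank `< n + 1`. -/
def singularValue (T : E →L[(Quaternion ℝ)ᵐᵒᵖ] E) (n : ℕ) : ℝ :=
  sInf {r : ℝ | ∃ F : E →L[(Quaternion ℝ)ᵐᵒᵖ] E,
    (F : E →ₗ[(Quaternion ℝ)ᵐᵒᵖ] E).rank < ((n + 1 : ℕ) : Cardinal) ∧ r = opNorm (T - F)}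

/-- `T` belongs to the Schatten-von Neumann class `S_p`. -/
def IsSchatten (p : ℝ) (T : E →L[(Quaternion ℝ)ᵐᵒᵖ] E) : Prop :=
  IsCompactOperator (T : E → E) ∧ Summable fun n : ℕ => singularValue T n ^ p

/-- The Schatten norm of an operator in the class `S_p`. -/
def schattenNorm (p : ℝ) (T : E →L[(Quaternion ℝ)ᵐᵒᵖ] E) : ℝ :=
  (∑' n : ℕ, singularValue T n ^ p) ^ (1 / p)

/-- The complex number `z` is a standard eigenvalue of `T`: it is a right eigenvalue, `T v = v z`
for some `v ≠ 0`, with nonnegative imaginary part. -/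
def IsStandardEigenvalue (T : E →L[(Quaternion ℝ)ᵐᵒᵖ] E) (z : ℂ) : Prop :=
  0 ≤ z.im ∧ ∃ v : E, v ≠ 0 ∧ T v = op (z : Quaternion ℝ) • v

/-- The eigenvectors and generalized eigenvectors of `T` for `z` (together with `0`):
the vectors annihilated by some iterate of `v ↦ T v - v z`. -/
def generalizedEigenvectors (T : E →L[(Quaternion ℝ)ᵐᵒᵖ] E) (z : ℂ) : Set E :=
  {v : E | ∃ m : ℕ, (fun w : E => T w - op (z : Quaternion ℝ) • w)^[m] v = 0}

/-- The (algebraic) multiplicity of `z`: the quaternionic dimension of the right quaternionic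
subspace spanned by the generalized eigenvectors for `z` (`⊤` if it is infinite). -/
def multiplicity (T : E →L[(Quaternion ℝ)ᵐᵒᵖ] E) (z : ℂ) : ℕ∞ :=
  Cardinal.toENat (Module.rank (Quaternion ℝ)ᵐᵒᵖ
    (Submodule.span (Quaternion ℝ)ᵐᵒᵖ (generalizedEigenvectors T z)))

/-- `l` is a sequence of standard eigenvalues of `T`: it lists each nonzero standard eigenvalue as
often as its multiplicity says, and all its other entries are `0`. -/
def IsStandardEigenvalueSequence (T : E →L[(Quaternion ℝ)ᵐᵒᵖ] E) (l : ℕ → ℂ) : Prop :=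
  (∀ k : ℕ, l k = 0 ∨ IsStandardEigenvalue T (l k)) ∧
    ∀ z : ℂ, z ≠ 0 → IsStandardEigenvalue T z → {k : ℕ | l k = z}.encard = multiplicity T z

end QuaternionicOperator

end

/-! Restrict scalars along `ℂ → ℍ`: the space becomes a complex inner product space with the same
norm, and complex dimensions are twice the quaternionic ones. An approximant of quaternionic rank at
most `n` has complex rank at most `2n`, so the complex approximation numbers of `T` are bounded by
its singular values, each listed twice (`approximationNumbersLE_complexify`). The complex Weyl
inequality then bounds the sum over nonzero complex eigenvalues by `2 ∑ μ_n ^ p`. Eigenvalues double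
as well: right multiplication by `j` matches the generalized eigenspaces of `z` and its conjugate,
and for real `z` the generalized eigenspace is already a quaternionic subspace
(`two_mul_toNat_multiplicity_le`). Cancelling the 2 gives the theorem.

The complex inequality is proved on finite-dimensional invariant subspaces. A Schur basis puts the
eigenvalues on the diagonal; a singular value decomposition dominates the diagonal by a doubly
substochastic matrix applied to the singular values, and convexity of `t ^ p` finishes
(`sum_norm_diagonal_rpow_le`). The resulting bound is uniform in the subspace, so it also yields
finite multiplicities and countably many eigenvalues. -/

noncomputable section

/-! ### Weyl's inequality in finite-dimensional complex spaces. -/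

section ComplexWeyl

open Module

variable {V : Type*} [NormedAddCommGroup V] [InnerProductSpace ℂ V]

/-- **Schur triangularization** of an endomorphism of a finite-dimensional complex space. -/
theorem exists_orthonormalBasis_upperTriangular (n : ℕ) :
    ∀ {V : Type*} [NormedAddCommGroup V] [InnerProductSpace ℂ V] [FiniteDimensional ℂ V]
      (A : V →ₗ[ℂ] V), finrank ℂ V = n →
      ∃ b : OrthonormalBasis (Fin n) ℂ V, ∀ i j, j < i → inner ℂ (b i) (A (b j)) = 0 := by
  induction n with
  | zero =>
    intro V _ _ _ A hV
    exact ⟨(stdOrthonormalBasis ℂ V).reindex (finCongr hV), fun i => i.elim0⟩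
  | succ n ih =>
    intro V _ _ _ A hV
    have : Nontrivial V := nontrivial_of_finrank_pos (R := ℂ) (by omega)
    -- An eigenvector of the adjoint has an `A`-invariant orthogonal complement; placed last in the
    -- basis, it keeps the matrix upper triangular.
    obtain ⟨c, hc⟩ := Module.End.exists_eigenvalue (LinearMap.adjoint A)
    obtain ⟨v, hv⟩ := hc.exists_hasEigenvector
    have hv0 : v ≠ 0 := hv.2
    have hAv : LinearMap.adjoint A v = c • v := hv.apply_eq_smul
    have : Fact (finrank ℂ V = n + 1) := ⟨hV⟩
    have hW : finrank ℂ (ℂ ∙ v)ᗮ = n := Submodule.finrank_orthogonal_span_singleton hv0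
    have hmem : ∀ x ∈ (ℂ ∙ v)ᗮ, A x ∈ (ℂ ∙ v)ᗮ := by
      intro x hx
      rw [Submodule.mem_orthogonal_singleton_iff_inner_right] at hx ⊢
      rw [← LinearMap.adjoint_inner_left, hAv, inner_smul_left, hx, mul_zero]
    obtain ⟨b, hb⟩ := ih (A.restrict hmem) hW
    let u : V := ((‖v‖ : ℂ)⁻¹) • v
    have hu : ‖u‖ = 1 := by
      simp [u, norm_smul, hv0]
    have huW : ∀ x ∈ (ℂ ∙ v)ᗮ, inner ℂ u x = 0 := by
      intro x hx
      rw [Submodule.mem_orthogonal_singleton_iff_inner_right] at hx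
      simp [u, hx]
    let w : Fin (n + 1) → V := Fin.snoc (fun i => (b i : V)) u
    have hw : Orthonormal ℂ w := by
      rw [orthonormal_iff_ite]
      intro i j
      have hbo := orthonormal_iff_ite.1 b.orthonormal
      refine Fin.lastCases ?_ (fun i => ?_) i <;> refine Fin.lastCases ?_ (fun j => ?_) j
      · simp [w, hu]
      · simp [w, huW _ (b j).2, (Fin.castSucc_lt_last j).ne']
      · have := huW _ (b i).2
        rw [inner_eq_zero_symm] at this
        simp [w, this, (Fin.castSucc_lt_last i).ne]
      · simpa [w] using hbo i j
    let B := OrthonormalBasis.mk hw (by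
      rw [(hw.linearIndependent.span_eq_top_of_card_eq_finrank' (by simp [hV]))])
    refine ⟨B, fun i j hij => ?_⟩
    have hB : ⇑B = w := OrthonormalBasis.coe_mk _ _
    rw [hB]
    revert hij
    refine Fin.lastCases ?_ (fun j => ?_) j
    · intro h
      exact absurd h (not_lt.2 (Fin.le_last i))
    · refine Fin.lastCases ?_ (fun i => ?_) i
      · intro _
        simpa [w] using huW _ (hmem _ (b j).2)
      · intro h
        simpa [w] using hb i j (by simpa using h)

theorem exists_orthonormalBasis_charpoly_eq_prod [FiniteDimensional ℂ V] (A : V →ₗ[ℂ] V) :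
    ∃ b : OrthonormalBasis (Fin (finrank ℂ V)) ℂ V,
      A.charpoly = ∏ i, (Polynomial.X - Polynomial.C (inner ℂ (b i) (A (b i)))) := by
  obtain ⟨b, hb⟩ := exists_orthonormalBasis_upperTriangular _ A rfl
  refine ⟨b, ?_⟩
  have hM : ∀ i j, LinearMap.toMatrix b.toBasis b.toBasis A i j = inner ℂ (b i) (A (b j)) := by
    intro i j
    simp [LinearMap.toMatrix_apply, OrthonormalBasis.repr_apply_apply]
  rw [← LinearMap.charpoly_toMatrix A b.toBasis, Matrix.charpoly_of_isUpperTriangular]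
  · simp only [hM]
  · intro i j hij
    rw [hM]
    exact hb i j hij

/-- A **singular value decomposition** `A = ∑ i, s i • ⟪g i, ·⟫ f i`, in which the nonzero ones among
the vectors `f i` are orthonormal. -/
theorem exists_singularValueDecomposition [FiniteDimensional ℂ V] (A : V →ₗ[ℂ] V) :
    ∃ (g : OrthonormalBasis (Fin (finrank ℂ V)) ℂ V) (f : Fin (finrank ℂ V) → V)
      (s : Fin (finrank ℂ V) → ℝ), Antitone s ∧ (∀ i, 0 ≤ s i) ∧ (∀ i, A (g i) = (s i : ℂ) • f i) ∧
      (∀ i, ‖f i‖ ≤ 1) ∧ (∀ x, ∑ i, ‖inner ℂ x (f i)‖ ^ 2 ≤ ‖x‖ ^ 2) ∧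
      ∀ x, ‖A x‖ ^ 2 = ∑ i, s i ^ 2 * ‖inner ℂ (g i) x‖ ^ 2 := by
  have hS := A.isSymmetric_adjoint_comp_self
  let g := hS.eigenvectorBasis rfl
  let s : Fin (finrank ℂ V) → ℝ := fun i => A.singularValues i
  have hs0 : ∀ i, 0 ≤ s i := fun i => A.singularValues_nonneg i
  have hg : ∀ i, LinearMap.adjoint A (A (g i)) = ((s i ^ 2 : ℝ) : ℂ) • g i := by
    intro i
    have := hS.apply_eigenvectorBasis rfl i
    rw [← A.sq_singularValues_fin rfl i] at this
    exact this
  have hinner : ∀ i j, inner ℂ (A (g i)) (A (g j)) = if i = j then ((s i ^ 2 : ℝ) : ℂ) else 0 := by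
    intro i j
    rw [← LinearMap.adjoint_inner_right, hg, inner_smul_right, orthonormal_iff_ite.1 g.orthonormal]
    split_ifs with h <;> simp [h]
  have hA : ∀ i, ‖A (g i)‖ = s i := by
    intro i
    have h := hinner i i
    rw [inner_self_eq_norm_sq_to_K, if_pos rfl] at h
    have h' : ‖A (g i)‖ ^ 2 = s i ^ 2 := Complex.ofReal_injective (by push_cast at h ⊢; exact h)
    exact (sq_eq_sq₀ (norm_nonneg _) (hs0 i)).1 h'
  -- Since `0⁻¹ = 0`, `f i` vanishes when `s i = 0`, so Bessel's inequality survives without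
  -- completing the family.
  let f : Fin (finrank ℂ V) → V := fun i => ((s i : ℂ)⁻¹) • A (g i)
  have hf : Orthonormal ℂ (fun i : {i // s i ≠ 0} => f i) := by
    rw [orthonormal_iff_ite]
    rintro ⟨i, hi⟩ ⟨j, hj⟩
    simp only [f, inner_smul_left, inner_smul_right, hinner, Subtype.mk.injEq]
    split_ifs with h
    · subst h
      have : (s i : ℂ) ≠ 0 := by exact_mod_cast hi
      simp
      field_simp
    · simp
  have hf0 : ∀ i, s i = 0 → f i = 0 := by
    intro i hi
    simp [f, hi]
  refine ⟨g, f, s, fun i j hij => A.singularValues_antitone hij, hs0, ?_, ?_, ?_, ?_⟩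
  · intro i
    by_cases hi : s i = 0
    · have : A (g i) = 0 := by rw [← norm_eq_zero, hA, hi]
      simp [this, hi]
    · have : (s i : ℂ) ≠ 0 := by exact_mod_cast hi
      simp only [f]
      rw [smul_inv_smul₀ this]
  · intro i
    by_cases hi : s i = 0
    · simp [hf0 i hi]
    · exact (hf.1 ⟨i, hi⟩).le
  · intro x
    have h1 : ∑ i, ‖inner ℂ x (f i)‖ ^ 2 = ∑ i : {i // s i ≠ 0}, ‖inner ℂ (f i) x‖ ^ 2 := by
      have : ∀ i, ‖inner ℂ x (f i)‖ ^ 2 = ‖inner ℂ (f i) x‖ ^ 2 := fun i => by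
        rw [norm_inner_symm]
      simp only [this]
      rw [← Finset.sum_subtype (Finset.univ.filter fun i => s i ≠ 0) (by simp)
        (fun i => ‖inner ℂ (f i) x‖ ^ 2)]
      refine (Finset.sum_subset (Finset.filter_subset _ _) ?_).symm
      intro i _ hi
      have : s i = 0 := by simpa using hi
      simp [hf0 i this]
    rw [h1]
    exact hf.sum_inner_products_le x
  · intro x
    have hx : LinearMap.adjoint A (A x) = ∑ i, inner ℂ (g i) x • ((s i ^ 2 : ℝ) : ℂ) • g i := by
      conv_lhs => rw [← g.sum_repr' x]
      simp only [map_sum, map_smul, hg]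
    have h2 : inner ℂ (A x) (A x) = ((∑ i, s i ^ 2 * ‖inner ℂ (g i) x‖ ^ 2 : ℝ) : ℂ) := by
      rw [← LinearMap.adjoint_inner_right, hx, inner_sum]
      push_cast
      refine Finset.sum_congr rfl fun i _ => ?_
      rw [inner_smul_right, inner_smul_right, ← inner_conj_symm x (g i)]
      have := Complex.mul_conj' (inner ℂ (g i) x)
      rw [← this]
      ring
    rw [inner_self_eq_norm_sq_to_K] at h2
    exact Complex.ofReal_injective (by push_cast at h2 ⊢; exact h2)

/-- The diagonal of `A` with respect to an orthonormal basis is dominated in `ℓ^p` by the distances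
of `A` to the maps of lower rank. -/
theorem sum_norm_diagonal_rpow_le [FiniteDimensional ℂ V] (A : V →ₗ[ℂ] V) {p : ℝ} (hp : 1 ≤ p)
    (e : OrthonormalBasis (Fin (finrank ℂ V)) ℂ V) (a : ℕ → ℝ)
    (ha : ∀ i, ∀ ε > 0, ∃ K : Submodule ℂ V, finrank ℂ V ≤ finrank ℂ K + i ∧
      ∀ x ∈ K, ‖A x‖ ≤ (a i + ε) * ‖x‖) :
    ∑ k, ‖inner ℂ (e k) (A (e k))‖ ^ p ≤ ∑ i ∈ Finset.range (finrank ℂ V), a i ^ p := by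
  obtain ⟨g, f, s, hs, hs0, hAg, hf1, hf, hnorm⟩ := exists_singularValueDecomposition A
  have hp0 : 0 < p := by linarith
  have hsa : ∀ i, s i ≤ a i := by
    intro i
    refine le_of_forall_pos_le_add fun ε hε => ?_
    obtain ⟨K, hK, hKA⟩ := ha i ε hε
    -- Min-max: `L` has dimension `i + 1` and `K` codimension at most `i`, so they share a nonzero
    -- `x`; there `A` stretches by at least `s i` and at most `a i + ε`.
    let L : Submodule ℂ V := Submodule.span ℂ (Set.range fun j : {j // j ≤ i} => g j)
    have hL : finrank ℂ L = i + 1 := by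
      have hli : LinearIndependent ℂ (fun j : {j // j ≤ i} => g j) :=
        g.orthonormal.linearIndependent.comp _ Subtype.val_injective
      rw [show finrank ℂ L = _ from finrank_span_eq_card hli]
      rw [Fintype.card_subtype]
      have : (Finset.univ.filter fun j => j ≤ i) = Finset.Iic i := by ext; simp
      rw [this, Fin.card_Iic]
    have hinf : 0 < finrank ℂ (K ⊓ L : Submodule ℂ V) := by
      have h1 := Submodule.finrank_sup_add_finrank_inf_eq K L
      have h2 := Submodule.finrank_le (K ⊔ L)
      omega
    have := nontrivial_of_finrank_pos hinf
    obtain ⟨⟨x, hxK, hxL⟩, hx0⟩ := exists_ne (0 : (K ⊓ L : Submodule ℂ V))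
    have hx0 : x ≠ 0 := fun h => hx0 (Subtype.ext h)
    have hperp : ∀ j, i < j → inner ℂ (g j) x = 0 := by
      intro j hj
      have hle : L ≤ (ℂ ∙ g j)ᗮ := by
        rw [Submodule.span_le]
        rintro _ ⟨⟨k, hk⟩, rfl⟩
        rw [SetLike.mem_coe, Submodule.mem_orthogonal_singleton_iff_inner_right]
        exact g.orthonormal.2 (hk.trans_lt hj).ne'
      exact Submodule.mem_orthogonal_singleton_iff_inner_right.1 (hle hxL)
    have h1 : (s i * ‖x‖) ^ 2 ≤ ‖A x‖ ^ 2 := by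
      rw [hnorm, mul_pow, ← g.sum_sq_norm_inner_right x, Finset.mul_sum]
      refine Finset.sum_le_sum fun j _ => ?_
      by_cases hj : i < j
      · simp [hperp j hj]
      · have := hs (not_lt.1 hj)
        have := hs0 i
        gcongr
    have h2 : s i * ‖x‖ ≤ (a i + ε) * ‖x‖ :=
      (abs_le_of_sq_le_sq' h1 (norm_nonneg _)).2.trans (hKA x hxK)
    exact le_of_mul_le_mul_right h2 (norm_pos_iff.2 hx0)
  -- Row and column sums are at most 1: split each product by AM-GM, then apply Parseval to `g` and
  -- Bessel to `f` (rows), or Parseval to `e` (columns).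
  let D : Fin (finrank ℂ V) → Fin (finrank ℂ V) → ℝ := fun k i =>
    ‖inner ℂ (g i) (e k)‖ * ‖inner ℂ (e k) (f i)‖
  have hD0 : ∀ k i, 0 ≤ D k i := fun k i => by positivity
  have hDle : ∀ k i, D k i ≤ (‖inner ℂ (g i) (e k)‖ ^ 2 + ‖inner ℂ (e k) (f i)‖ ^ 2) / 2 := by
    intro k i
    have := two_mul_le_add_sq ‖inner ℂ (g i) (e k)‖ ‖inner ℂ (e k) (f i)‖
    simp only [D]
    linarith
  have hrow : ∀ k, ∑ i, D k i ≤ 1 := by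
    intro k
    refine (Finset.sum_le_sum fun i _ => hDle k i).trans ?_
    rw [← Finset.sum_div, Finset.sum_add_distrib, g.sum_sq_norm_inner_right]
    have := hf (e k)
    simp only [OrthonormalBasis.norm_eq_one] at this ⊢
    linarith
  have hcol : ∀ i, ∑ k, D k i ≤ 1 := by
    intro i
    refine (Finset.sum_le_sum fun k _ => hDle k i).trans ?_
    rw [← Finset.sum_div, Finset.sum_add_distrib, e.sum_sq_norm_inner_right,
      e.sum_sq_norm_inner_left]
    have : ‖f i‖ ^ 2 ≤ 1 := pow_le_one₀ (norm_nonneg _) (hf1 i)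
    simp only [OrthonormalBasis.norm_eq_one]
    linarith
  have hdiag : ∀ k, ‖inner ℂ (e k) (A (e k))‖ ≤ ∑ i, D k i * s i := by
    intro k
    have h1 : A (e k) = ∑ i, inner ℂ (g i) (e k) • (s i : ℂ) • f i := by
      conv_lhs => rw [← g.sum_repr' (e k)]
      simp only [map_sum, map_smul, hAg]
    rw [h1, inner_sum]
    refine (norm_sum_le _ _).trans (Finset.sum_le_sum fun i _ => le_of_eq ?_)
    rw [inner_smul_right, inner_smul_right, norm_mul, norm_mul, Complex.norm_real,
      Real.norm_of_nonneg (hs0 i)]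
    ring
  have hpow : ∀ k, ‖inner ℂ (e k) (A (e k))‖ ^ p ≤ ∑ i, D k i * s i ^ p := by
    intro k
    have hnn : 0 ≤ ∑ i, D k i * s i ^ p :=
      Finset.sum_nonneg fun i _ => mul_nonneg (hD0 k i) (Real.rpow_nonneg (hs0 i) p)
    -- Weighted Hölder with weights `D k`; as their sum is at most 1, its factor with exponent `1 -
    -- p⁻¹` can be dropped.
    have h1 := (hdiag k).trans
      (Real.inner_le_weight_mul_Lp_of_nonneg Finset.univ hp (D k) s (hD0 k) hs0)
    have h2 : (∑ i, D k i) ^ (1 - p⁻¹) ≤ 1 :=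
      Real.rpow_le_one (Finset.sum_nonneg fun i _ => hD0 k i) (hrow k)
        (sub_nonneg.2 (inv_le_one_of_one_le₀ hp))
    have h3 : ‖inner ℂ (e k) (A (e k))‖ ≤ (∑ i, D k i * s i ^ p) ^ p⁻¹ :=
      h1.trans (mul_le_of_le_one_left (Real.rpow_nonneg hnn _) h2)
    calc _ ≤ ((∑ i, D k i * s i ^ p) ^ p⁻¹) ^ p :=
          Real.rpow_le_rpow (norm_nonneg _) h3 hp0.le
      _ = _ := Real.rpow_inv_rpow hnn hp0.ne'
  calc _ ≤ ∑ k, ∑ i, D k i * s i ^ p := Finset.sum_le_sum fun k _ => hpow k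
    _ = ∑ i, (∑ k, D k i) * s i ^ p := by
      rw [Finset.sum_comm]
      simp only [Finset.sum_mul]
    _ ≤ ∑ i : Fin (finrank ℂ V), a i ^ p := by
      refine Finset.sum_le_sum fun i _ => ?_
      have h1 : 0 ≤ s i ^ p := Real.rpow_nonneg (hs0 i) p
      exact (mul_le_of_le_one_left h1 (hcol i)).trans
        (Real.rpow_le_rpow (hs0 i) (hsa i) hp0.le)
    _ = _ := Fin.sum_univ_eq_sum_range (fun i => a i ^ p) _

/-- **Weyl's inequality** in a finite-dimensional space, for exponents `1 ≤ p`. -/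
theorem sum_finrank_maxGenEigenspace_mul_rpow_le [FiniteDimensional ℂ V] (A : V →ₗ[ℂ] V) {p : ℝ}
    (hp : 1 ≤ p) (a : ℕ → ℝ)
    (ha : ∀ i, ∀ ε > 0, ∃ K : Submodule ℂ V, finrank ℂ V ≤ finrank ℂ K + i ∧
      ∀ x ∈ K, ‖A x‖ ≤ (a i + ε) * ‖x‖) (S : Finset ℂ) :
    ∑ z ∈ S, (finrank ℂ (Module.End.maxGenEigenspace A z) : ℝ) * ‖z‖ ^ p ≤
      ∑ i ∈ Finset.range (finrank ℂ V), a i ^ p := by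
  obtain ⟨e, he⟩ := exists_orthonormalBasis_charpoly_eq_prod A
  refine le_trans ?_ (sum_norm_diagonal_rpow_le A hp e a ha)
  let d : Fin (finrank ℂ V) → ℂ := fun k => inner ℂ (e k) (A (e k))
  have hcard : ∀ z, finrank ℂ (Module.End.maxGenEigenspace A z) =
      (Finset.univ.filter fun k => d k = z).card := by
    intro z
    have hroots : A.charpoly.roots = Finset.univ.val.map d := by
      rw [he, ← Polynomial.roots_multiset_prod_X_sub_C (Finset.univ.val.map d), Multiset.map_map]
      rfl
    rw [LinearMap.finrank_maxGenEigenspace_eq, ← Polynomial.count_roots, hroots,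
      Multiset.count_map]
    simp only [eq_comm (a := z)]
    rfl
  calc _ = ∑ z ∈ S, ∑ k with d k = z, ‖d k‖ ^ p := by
        refine Finset.sum_congr rfl fun z _ => ?_
        rw [hcard, Finset.sum_congr rfl (g := fun _ => ‖z‖ ^ p), Finset.sum_const, nsmul_eq_mul]
        intro k hk
        rw [(Finset.mem_filter.1 hk).2]
    _ ≤ ∑ k, ‖d k‖ ^ p := by
        rw [Finset.sum_fiberwise_eq_sum_filter]
        exact Finset.sum_le_sum_of_subset_of_nonneg (Finset.filter_subset _ _)
          fun k _ _ => by positivity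

end ComplexWeyl

end

noncomputable section

/-! ### From finite-dimensional invariant subspaces to infinite dimension. -/

section ApproximationNumbers

open Module

theorem Submodule.finiteDimensional_of_finrank_le {K V : Type*} [DivisionRing K] [AddCommGroup V]
    [Module K V] (N : Submodule K V) (n : ℕ)
    (h : ∀ W ≤ N, FiniteDimensional K W → finrank K W ≤ n) : FiniteDimensional K N := by
  by_contra hN
  have h1 : ((n + 1 : ℕ) : Cardinal) ≤ Module.rank K N := by
    by_contra hlt
    exact hN (rank_lt_aleph0_iff.1 ((not_le.1 hlt).trans (Cardinal.natCast_lt_aleph0)))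
  obtain ⟨f, hf⟩ := exists_linearIndependent_of_le_rank h1
  have hf' : LinearIndependent K (fun i => (f i : V)) := hf.map' N.subtype N.ker_subtype
  have h2 := h (Submodule.span K (Set.range fun i => (f i : V)))
    (Submodule.span_le.2 (by rintro _ ⟨i, rfl⟩; exact (f i).2))
    (FiniteDimensional.span_of_finite K (Set.finite_range _))
  rw [finrank_span_eq_card hf', Fintype.card_fin] at h2
  omega

variable {U : Type*} [NormedAddCommGroup U] [InnerProductSpace ℂ U]

/-- The approximation numbers of `T`, numbered from `0`, are bounded by the sequence `a`. -/
def ApproximationNumbersLE (T : U →ₗ[ℂ] U) (a : ℕ → ℝ) : Prop :=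
  ∀ i, ∀ ε > 0, ∃ F : U →ₗ[ℂ] U, FiniteDimensional ℂ (LinearMap.range F) ∧
    finrank ℂ (LinearMap.range F) ≤ i ∧ ∀ x, ‖T x - F x‖ ≤ (a i + ε) * ‖x‖

variable {T : U →ₗ[ℂ] U} {a : ℕ → ℝ} {p C : ℝ}

/-- On the kernel in `M` of an approximant of rank at most `i`, `T` agrees with the error; that
kernel has codimension at most `i` in `M`. -/
theorem ApproximationNumbersLE.sum_finrank_comap_mul_rpow_le (hT : ApproximationNumbersLE T a)
    (hp : 1 ≤ p) (hC : ∀ N, ∑ i ∈ Finset.range N, a i ^ p ≤ C) (M : Submodule ℂ U)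
    [FiniteDimensional ℂ M] (hM : ∀ x ∈ M, T x ∈ M) (S : Finset ℂ) :
    ∑ z ∈ S, (finrank ℂ ((Module.End.maxGenEigenspace T z).comap M.subtype) : ℝ) * ‖z‖ ^ p ≤ C := by
  have h := sum_finrank_maxGenEigenspace_mul_rpow_le (T.restrict hM) hp a ?_ S
  · refine le_trans (le_of_eq (Finset.sum_congr rfl fun z _ => ?_)) (h.trans (hC _))
    rw [Module.End.maxGenEigenspace, Module.End.maxGenEigenspace, Module.End.genEigenspace_restrict]
  · intro i ε hε
    obtain ⟨F, hF, hFi, hTF⟩ := hT i ε hε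
    refine ⟨LinearMap.ker (F ∘ₗ M.subtype), ?_, ?_⟩
    · have h1 := LinearMap.finrank_range_add_finrank_ker (F ∘ₗ M.subtype)
      have h2 : finrank ℂ (LinearMap.range (F ∘ₗ M.subtype)) ≤ finrank ℂ (LinearMap.range F) :=
        Submodule.finrank_mono (LinearMap.range_comp_le_range _ _)
      omega
    · intro x hx
      have hx' : F x = 0 := hx
      have := hTF x
      rw [hx', sub_zero] at this
      exact this

theorem ApproximationNumbersLE.finrank_mul_rpow_le (hT : ApproximationNumbersLE T a)
    (hp : 1 ≤ p) (hC : ∀ N, ∑ i ∈ Finset.range N, a i ^ p ≤ C) {z : ℂ} (M : Submodule ℂ U)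
    [FiniteDimensional ℂ M] (hM : ∀ x ∈ M, T x ∈ M) (hMz : M ≤ Module.End.maxGenEigenspace T z) :
    (finrank ℂ M : ℝ) * ‖z‖ ^ p ≤ C := by
  have h := hT.sum_finrank_comap_mul_rpow_le hp hC M hM {z}
  rwa [Finset.sum_singleton, Submodule.comap_subtype_eq_top.2 hMz, finrank_top] at h

/-- Weyl's inequality caps the dimension of every finite-dimensional invariant subspace of the
generalized eigenspace by the same `C / ‖z‖ ^ p`. -/
theorem ApproximationNumbersLE.finiteDimensional_maxGenEigenspace (hT : ApproximationNumbersLE T a)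
    (hp : 1 ≤ p) (hC : ∀ N, ∑ i ∈ Finset.range N, a i ^ p ≤ C) {z : ℂ} (hz : z ≠ 0) :
    FiniteDimensional ℂ (Module.End.maxGenEigenspace T z) := by
  have hz' : 0 < ‖z‖ ^ p := Real.rpow_pos_of_pos (norm_pos_iff.2 hz) p
  have hbound : ∀ M : Submodule ℂ U, FiniteDimensional ℂ M → (∀ x ∈ M, T x ∈ M) →
      M ≤ Module.End.maxGenEigenspace T z → finrank ℂ M ≤ ⌊C / ‖z‖ ^ p⌋₊ := by
    intro M _ hM hMz
    exact Nat.le_floor ((le_div_iff₀ hz').2 (hT.finrank_mul_rpow_le hp hC M hM hMz))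
  have hle : ∀ k : ℕ, Module.End.genEigenspace T z k ≤ Module.End.maxGenEigenspace T z :=
    fun k => (Module.End.genEigenspace T z).monotone le_top
  have hinv : ∀ k : ℕ, ∀ x ∈ Module.End.genEigenspace T z k, T x ∈ Module.End.genEigenspace T z k :=
    fun k => Module.End.mapsTo_genEigenspace_of_comm (Commute.refl T) z k
  -- Every subspace of the eigenspace is invariant, so the cap applies before finiteness is known.
  have hone : FiniteDimensional ℂ (Module.End.genEigenspace T z 1) := by
    refine Submodule.finiteDimensional_of_finrank_le _ ⌊C / ‖z‖ ^ p⌋₊ fun W hW hWf => ?_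
    refine hbound W hWf (fun x hx => ?_) (hW.trans (mod_cast hle 1))
    rw [Module.End.mem_genEigenspace_one.1 (hW hx)]
    exact W.smul_mem _ hx
  have hnat : ∀ k : ℕ, FiniteDimensional ℂ (Module.End.genEigenspace T z k) := by
    intro k
    induction k with
    | zero =>
      rw [Nat.cast_zero, Module.End.genEigenspace_zero]
      infer_instance
    | succ k ih =>
      rw [Module.End.genEigenspace_nat] at ih ⊢
      rw [Module.End.genEigenspace_one] at hone
      -- `T - z` maps level `k + 1` into level `k` with kernel in the eigenspace, both
      -- finite-dimensional.
      refine Module.Finite.iff_fg.2 (Submodule.fg_of_fg_map_of_fg_inf_ker (T - z • 1)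
        (Module.Finite.iff_fg.1 (Submodule.finiteDimensional_of_le
          (S₂ := LinearMap.ker ((T - z • 1) ^ k)) (Submodule.map_le_iff_le_comap.2
          fun x hx => ?_)))
        (Module.Finite.iff_fg.1 (Submodule.finiteDimensional_of_le
          (S₂ := LinearMap.ker (T - z • 1)) inf_le_right)))
      rw [pow_succ] at hx
      exact hx
  refine Submodule.finiteDimensional_of_finrank_le _ ⌊C / ‖z‖ ^ p⌋₊ fun W hW hWf => ?_
  -- `W` need not be invariant, but being finite-dimensional it lies in one level of the increasing
  -- union, which is.
  have hk : ∃ k : ℕ, W ≤ Module.End.genEigenspace T z k := by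
    have hc := (Submodule.fg_iff_compact W).1 (Module.Finite.iff_fg.1 hWf)
    rw [Module.End.maxGenEigenspace, Module.End.genEigenspace_top] at hW
    obtain ⟨s, hs⟩ := CompleteLattice.IsCompactElement.exists_finset_of_le_iSup _ hc _ hW
    refine ⟨s.sup id, hs.trans (iSup₂_le fun i hi => ?_)⟩
    exact (Module.End.genEigenspace T z).monotone (mod_cast Finset.le_sup (f := id) hi)
  obtain ⟨k, hk⟩ := hk
  have := hnat k
  exact (Submodule.finrank_mono hk).trans (hbound _ (hnat k) (hinv k) (hle k))

theorem ApproximationNumbersLE.sum_finrank_mul_rpow_le (hT : ApproximationNumbersLE T a)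
    (hp : 1 ≤ p) (hC : ∀ N, ∑ i ∈ Finset.range N, a i ^ p ≤ C) (S : Finset ℂ) (hS : 0 ∉ S) :
    ∑ z ∈ S, (finrank ℂ (Module.End.maxGenEigenspace T z) : ℝ) * ‖z‖ ^ p ≤ C := by
  have hfin : ∀ z : S, FiniteDimensional ℂ (Module.End.maxGenEigenspace T (z : ℂ)) := fun z =>
    hT.finiteDimensional_maxGenEigenspace hp hC fun h => hS (h ▸ z.2)
  let M : Submodule ℂ U := ⨆ z : S, Module.End.maxGenEigenspace T (z : ℂ)
  have hMf : FiniteDimensional ℂ M := Submodule.finiteDimensional_iSup _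
  have hinv : ∀ x ∈ M, T x ∈ M := by
    have : M ≤ M.comap T := by
      refine iSup_le fun z x hx => ?_
      exact Submodule.mem_iSup_of_mem z
        (Module.End.mapsTo_maxGenEigenspace_of_comm (Commute.refl T) (z : ℂ) hx)
    exact this
  refine le_trans (le_of_eq (Finset.sum_congr rfl fun z hz => ?_))
    (hT.sum_finrank_comap_mul_rpow_le hp hC M hinv S)
  rw [(Submodule.comapSubtypeEquivOfLe (le_iSup (fun z : S =>
    Module.End.maxGenEigenspace T (z : ℂ)) ⟨z, hz⟩)).finrank_eq]

end ApproximationNumbers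

end

noncomputable section

/-! ### Quaternionic spaces as complex spaces of twice the dimension. -/

section ComplexStructure

open Module

/-- The complex numbers, acting from the right through the quaternions. -/
def complexToQuaternionOp : ℂ →+* (Quaternion ℝ)ᵐᵒᵖ where
  toFun z := op (z : Quaternion ℝ)
  map_one' := by simp
  map_mul' z w := by rw [mul_comm, Quaternion.coeComplex_mul, op_mul]
  map_zero' := by simp
  map_add' z w := by rw [Quaternion.coeComplex_add, op_add]

/-- The complex vector space structure on the quaternions given by right multiplication. -/
abbrev quaternionOpComplexModule : Module ℂ (Quaternion ℝ)ᵐᵒᵖ :=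
  Module.compHom _ complexToQuaternionOp

attribute [local instance] quaternionOpComplexModule

theorem complex_smul_quaternionOp (z : ℂ) (q : (Quaternion ℝ)ᵐᵒᵖ) :
    z • q = op (z : Quaternion ℝ) * q := rfl

theorem rank_complex_quaternionOp : Module.rank ℂ (Quaternion ℝ)ᵐᵒᵖ = 2 := by
  have : IsScalarTower ℝ ℂ (Quaternion ℝ)ᵐᵒᵖ := ⟨fun r z q => by
    rw [complex_smul_quaternionOp, complex_smul_quaternionOp, ← smul_mul_assoc, ← op_smul]
    congr 2
    ext <;> simp⟩
  have : Module.Finite ℝ (Quaternion ℝ)ᵐᵒᵖ := Module.Finite.equiv (opLinearEquiv ℝ)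
  have : Module.Finite ℂ (Quaternion ℝ)ᵐᵒᵖ := Module.Finite.of_restrictScalars_finite ℝ ℂ _
  have h4 : finrank ℝ (Quaternion ℝ)ᵐᵒᵖ = 4 := by
    rw [← (opLinearEquiv (M := Quaternion ℝ) ℝ).finrank_eq]
    exact Quaternion.finrank_eq_four
  have h2 := finrank_mul_finrank ℝ ℂ (Quaternion ℝ)ᵐᵒᵖ
  rw [h4, Complex.finrank_real_complex] at h2
  rw [← finrank_eq_rank, show finrank ℂ (Quaternion ℝ)ᵐᵒᵖ = 2 by omega]
  rfl

variable {E : Type*} [NormedAddCommGroup E] [Module (Quaternion ℝ)ᵐᵒᵖ E]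
  [QuaternionicInnerProductSpace E]

namespace QuaternionicInnerProductSpace

theorem inner_smul_left' (x y : E) (q : Quaternion ℝ) :
    inner (Quaternion ℝ) (op q • x) y = star q * inner (Quaternion ℝ) x y := by
  rw [← star_inner, inner_smul_right, star_mul, star_inner]

theorem norm_op_smul (q : Quaternion ℝ) (x : E) : ‖op q • x‖ = ‖q‖ * ‖x‖ := by
  have h := norm_sq_eq_inner (op q • x)
  rw [inner_smul_right, inner_smul_left', ← norm_sq_eq_inner, mul_assoc,
    (Quaternion.coe_commutes (‖x‖ ^ 2) q), ← mul_assoc, Quaternion.star_mul_self,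
    Quaternion.normSq_eq_norm_mul_self, ← Quaternion.coe_mul, Quaternion.coe_inj] at h
  rw [← sq_eq_sq₀ (norm_nonneg _) (by positivity), h]
  ring

/-- A quaternionic inner product space is a complex one, for the complex part of the inner
product. -/
abbrev complexInnerProductSpace : InnerProductSpace ℂ E where
  toModule := Module.compHom E complexToQuaternionOp
  norm_smul_le z x := by
    refine (norm_op_smul (z : Quaternion ℝ) x).le.trans (le_of_eq ?_)
    congr 1
    rw [← sq_eq_sq₀ (norm_nonneg _) (norm_nonneg _), sq, ← Quaternion.normSq_eq_norm_mul_self,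
      Quaternion.normSq_def', Complex.sq_norm, Complex.normSq_apply]
    simp [sq]
  inner x y := ⟨(inner (Quaternion ℝ) x y).re, (inner (Quaternion ℝ) x y).imI⟩
  norm_sq_eq_re_inner x := by
    have := congrArg QuaternionAlgebra.re (norm_sq_eq_inner x)
    rw [Quaternion.re_coe] at this
    exact this
  conj_inner_symm x y := by
    rw [← star_inner x y]
    apply Complex.ext <;> simp
  add_left x y z := by
    have : inner (Quaternion ℝ) (x + y) z = inner (Quaternion ℝ) x z + inner (Quaternion ℝ) y z := by
      rw [← star_inner, inner_add_right, star_add, star_inner, star_inner]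
    apply Complex.ext <;> simp [this]
  smul_left x y z := by
    have : inner (Quaternion ℝ) (op (z : Quaternion ℝ) • x) y = _ := inner_smul_left' x y z
    change (⟨(inner (Quaternion ℝ) (op (z : Quaternion ℝ) • x) y).re,
      (inner (Quaternion ℝ) (op (z : Quaternion ℝ) • x) y).imI⟩ : ℂ) = _
    rw [this]
    apply Complex.ext <;> simp

attribute [local instance] complexInnerProductSpace

theorem complex_smul_eq (z : ℂ) (x : E) : z • x = op (z : Quaternion ℝ) • x := rfl

theorem isScalarTower_complex : IsScalarTower ℂ (Quaternion ℝ)ᵐᵒᵖ E :=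
  ⟨fun z q x => by rw [complex_smul_quaternionOp, mul_smul, complex_smul_eq]⟩

attribute [local instance] isScalarTower_complex

theorem rank_restrictScalars_complex (N : Submodule (Quaternion ℝ)ᵐᵒᵖ E) :
    Module.rank ℂ (N.restrictScalars ℂ) = 2 * Module.rank (Quaternion ℝ)ᵐᵒᵖ N := by
  have h := lift_rank_mul_lift_rank ℂ (Quaternion ℝ)ᵐᵒᵖ N
  rw [rank_complex_quaternionOp] at h
  exact (by simpa using h.symm : Module.rank ℂ N = 2 * Module.rank (Quaternion ℝ)ᵐᵒᵖ N)

end QuaternionicInnerProductSpace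

end ComplexStructure

end

noncomputable section

/-! ### Singular values and generalized eigenspaces under complexification. -/

namespace QuaternionicOperator

open Module QuaternionicInnerProductSpace

variable {E : Type*} [NormedAddCommGroup E] [Module (Quaternion ℝ)ᵐᵒᵖ E]

theorem opNorm_nonneg (T : E →L[(Quaternion ℝ)ᵐᵒᵖ] E) : 0 ≤ opNorm T :=
  Real.sInf_nonneg fun _ hc => hc.1

theorem singularValue_nonneg (T : E →L[(Quaternion ℝ)ᵐᵒᵖ] E) (n : ℕ) : 0 ≤ singularValue T n :=
  Real.sInf_nonneg (by rintro _ ⟨F, _, rfl⟩; exact opNorm_nonneg _)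

theorem exists_opNorm_sub_lt (T : E →L[(Quaternion ℝ)ᵐᵒᵖ] E) (n : ℕ) {ε : ℝ} (hε : 0 < ε) :
    ∃ F : E →L[(Quaternion ℝ)ᵐᵒᵖ] E,
      (F : E →ₗ[(Quaternion ℝ)ᵐᵒᵖ] E).rank ≤ n ∧ opNorm (T - F) < singularValue T n + ε := by
  have hne : {r : ℝ | ∃ F : E →L[(Quaternion ℝ)ᵐᵒᵖ] E,
      (F : E →ₗ[(Quaternion ℝ)ᵐᵒᵖ] E).rank < ((n + 1 : ℕ) : Cardinal) ∧
        r = opNorm (T - F)}.Nonempty := by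
    refine ⟨_, 0, ?_, rfl⟩
    rw [ContinuousLinearMap.toLinearMap_zero, LinearMap.rank_zero]
    exact_mod_cast n.succ_pos
  obtain ⟨_, ⟨F, hF, rfl⟩, hr⟩ := exists_lt_of_csInf_lt hne (lt_add_of_pos_right _ hε)
  refine ⟨F, ?_, hr⟩
  obtain ⟨m, hm⟩ := Cardinal.lt_aleph0.1 (hF.trans Cardinal.natCast_lt_aleph0)
  rw [hm] at hF ⊢
  exact_mod_cast Nat.lt_succ_iff.1 (by exact_mod_cast hF)

theorem sum_range_singularValue_half_le (T : E →L[(Quaternion ℝ)ᵐᵒᵖ] E) {p : ℝ}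
    (hT : Summable fun n : ℕ => singularValue T n ^ p) (N : ℕ) :
    ∑ i ∈ Finset.range N, singularValue T (i / 2) ^ p ≤ 2 * ∑' n, singularValue T n ^ p := by
  have hnn : ∀ n, 0 ≤ singularValue T n ^ p := fun n => Real.rpow_nonneg (singularValue_nonneg T n) p
  have h2 : ∀ N : ℕ, ∑ i ∈ Finset.range (2 * N), singularValue T (i / 2) ^ p =
      2 * ∑ i ∈ Finset.range N, singularValue T i ^ p := by
    intro N
    induction N with
    | zero => simp
    | succ N ih =>
      rw [Nat.mul_succ, Finset.sum_range_succ, Finset.sum_range_succ, ih, Finset.sum_range_succ,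
        show (2 * N + 1) / 2 = N by omega, show 2 * N / 2 = N by omega]
      ring
  calc _ ≤ ∑ i ∈ Finset.range (2 * N), singularValue T (i / 2) ^ p :=
        Finset.sum_le_sum_of_subset_of_nonneg (Finset.range_mono (by omega)) fun i _ _ => hnn _
    _ ≤ _ := by
        rw [h2]
        exact mul_le_mul_of_nonneg_left (hT.sum_le_tsum _ fun i _ => hnn i) zero_le_two

variable [QuaternionicInnerProductSpace E]

attribute [local instance] quaternionOpComplexModule complexInnerProductSpace isScalarTower_complex

theorem norm_apply_le_opNorm (T : E →L[(Quaternion ℝ)ᵐᵒᵖ] E) (x : E) :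
    ‖T x‖ ≤ opNorm T * ‖x‖ :=
  -- `opNorm T` is by definition the same infimum as the norm of the complex restriction.
  (T.restrictScalars ℂ).le_opNorm x

/-- The operator `T`, regarded as a complex linear map. -/
def complexify (T : E →L[(Quaternion ℝ)ᵐᵒᵖ] E) : E →ₗ[ℂ] E :=
  (T : E →ₗ[(Quaternion ℝ)ᵐᵒᵖ] E).restrictScalars ℂ

theorem approximationNumbersLE_complexify (T : E →L[(Quaternion ℝ)ᵐᵒᵖ] E) :
    ApproximationNumbersLE (complexify T) fun i => singularValue T (i / 2) := by
  intro i ε hε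
  obtain ⟨F, hF, hTF⟩ := exists_opNorm_sub_lt T (i / 2) hε
  have hrank : Module.rank ℂ (LinearMap.range (complexify F)) ≤ i := by
    have h := rank_restrictScalars_complex (LinearMap.range (F : E →ₗ[(Quaternion ℝ)ᵐᵒᵖ] E))
    calc Module.rank ℂ (LinearMap.range (complexify F))
        = 2 * (F : E →ₗ[(Quaternion ℝ)ᵐᵒᵖ] E).rank := h
      _ ≤ 2 * ((i / 2 : ℕ) : Cardinal) := by gcongr
      _ ≤ i := by exact_mod_cast Nat.mul_div_le i 2
  refine ⟨complexify F, rank_lt_aleph0_iff.1 (hrank.trans_lt Cardinal.natCast_lt_aleph0),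
    finrank_le_of_rank_le hrank, fun x => ?_⟩
  exact (norm_apply_le_opNorm (T - F) x).trans (by gcongr)

theorem generalizedEigenvectors_eq (T : E →L[(Quaternion ℝ)ᵐᵒᵖ] E) (z : ℂ) :
    generalizedEigenvectors T z = Module.End.maxGenEigenspace (complexify T) z := by
  ext v
  rw [SetLike.mem_coe, Module.End.mem_maxGenEigenspace]
  refine exists_congr fun m => ?_
  rw [Module.End.pow_apply]
  rfl

/-- Right multiplication by `q` intertwines `T - z` with `T - w`. It is used with `q = ±j`, and with
arbitrary `q` when `z = w` is real. -/
theorem mem_maxGenEigenspace_op_smul (T : E →L[(Quaternion ℝ)ᵐᵒᵖ] E) {z w : ℂ} {q : Quaternion ℝ}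
    (hq : (z : Quaternion ℝ) * q = q * (w : Quaternion ℝ)) {v : E}
    (hv : v ∈ Module.End.maxGenEigenspace (complexify T) z) :
    op q • v ∈ Module.End.maxGenEigenspace (complexify T) w := by
  rw [← SetLike.mem_coe, ← generalizedEigenvectors_eq] at hv ⊢
  obtain ⟨m, hm⟩ := hv
  refine ⟨m, ?_⟩
  have hsemi : Function.Semiconj (fun x : E => op q • x)
      (fun x : E => T x - op (z : Quaternion ℝ) • x)
      (fun x : E => T x - op (w : Quaternion ℝ) • x) := by
    intro x
    simp only [map_smul, smul_sub, smul_smul, ← op_mul, hq]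
  have h := (hsemi.iterate_right m) v
  simp only [hm, smul_zero] at h
  exact h.symm

theorem finrank_maxGenEigenspace_conj (T : E →L[(Quaternion ℝ)ᵐᵒᵖ] E) (z : ℂ) :
    finrank ℂ (Module.End.maxGenEigenspace (complexify T) (starRingEnd ℂ z)) =
      finrank ℂ (Module.End.maxGenEigenspace (complexify T) z) := by
  obtain ⟨j, hre, himI, himJ, himK⟩ :
      ∃ j : Quaternion ℝ, j.re = 0 ∧ j.imI = 0 ∧ j.imJ = 1 ∧ j.imK = 0 :=
    ⟨⟨0, 0, 1, 0⟩, rfl, rfl, rfl, rfl⟩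
  have hj : j * j = -1 := by
    ext <;> simp [hre, himI, himJ, himK, Quaternion.re_one, Quaternion.imI_one, Quaternion.imJ_one,
      Quaternion.imK_one]
  have hzj : ∀ z : ℂ, (z : Quaternion ℝ) * j = j * (starRingEnd ℂ z : ℂ) := by
    intro z
    ext <;> simp [hre, himI, himJ, himK]
  have hzj' : ((starRingEnd ℂ z : ℂ) : Quaternion ℝ) * -j = -j * z := by
    ext <;> simp [hre, himI, himJ, himK]
  let e : Module.End.maxGenEigenspace (complexify T) z ≃+
      Module.End.maxGenEigenspace (complexify T) (starRingEnd ℂ z) :=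
    { toFun := fun v => ⟨op j • (v : E), mem_maxGenEigenspace_op_smul T (hzj z) v.2⟩
      invFun := fun v => ⟨op (-j) • (v : E), mem_maxGenEigenspace_op_smul T hzj' v.2⟩
      left_inv := fun v => Subtype.ext (by simp [smul_smul, ← op_mul, hj])
      right_inv := fun v => Subtype.ext (by simp [smul_smul, ← op_mul, hj])
      map_add' := fun v w => Subtype.ext (smul_add _ _ _) }
  -- Multiplication by `j` is only conjugate-linear, which still preserves dimension.
  refine (congrArg Cardinal.toNat (rank_eq_of_equiv_equiv (starRingEnd ℂ) e
    star_involutive.bijective fun r v => Subtype.ext ?_)).symm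
  change op j • op (r : Quaternion ℝ) • (v : E) =
    op ((starRingEnd ℂ r : ℂ) : Quaternion ℝ) • op j • (v : E)
  rw [smul_smul, smul_smul, ← op_mul, ← op_mul, hzj]

/-- A complex basis of the generalized eigenspace spans over the quaternions. This suffices for
nonreal `z`; real `z` needs the factor 2 of the next lemma. -/
theorem rank_span_generalizedEigenvectors_le (T : E →L[(Quaternion ℝ)ᵐᵒᵖ] E) (z : ℂ)
    [FiniteDimensional ℂ (Module.End.maxGenEigenspace (complexify T) z)] :
    Module.rank (Quaternion ℝ)ᵐᵒᵖ
        (Submodule.span (Quaternion ℝ)ᵐᵒᵖ (generalizedEigenvectors T z)) ≤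
      finrank ℂ (Module.End.maxGenEigenspace (complexify T) z) := by
  let G := Module.End.maxGenEigenspace (complexify T) z
  let b := Module.finBasis ℂ G
  let R : Set E := Set.range fun i => (b i : E)
  have hle : Submodule.span (Quaternion ℝ)ᵐᵒᵖ (generalizedEigenvectors T z) ≤
      Submodule.span (Quaternion ℝ)ᵐᵒᵖ R := by
    rw [Submodule.span_le, generalizedEigenvectors_eq]
    intro v hv
    have h := congrArg Subtype.val (b.sum_repr ⟨v, hv⟩)
    rw [← show _ = v from h, AddSubmonoidClass.coe_finsetSum]
    refine Submodule.sum_mem _ fun i _ => ?_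
    exact Submodule.smul_mem _ (op ((b.repr ⟨v, hv⟩ i : ℂ) : Quaternion ℝ))
      (Submodule.subset_span ⟨i, rfl⟩)
  calc _ ≤ Module.rank (Quaternion ℝ)ᵐᵒᵖ (Submodule.span (Quaternion ℝ)ᵐᵒᵖ R) :=
        Submodule.rank_mono hle
    _ ≤ Cardinal.mk R := rank_span_le R
    _ ≤ _ := by
        have := Cardinal.mk_range_le_lift (f := fun i => (b i : E))
        simpa using this

theorem two_mul_rank_span_generalizedEigenvectors (T : E →L[(Quaternion ℝ)ᵐᵒᵖ] E) {z : ℂ}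
    (hz : z.im = 0) :
    2 * Module.rank (Quaternion ℝ)ᵐᵒᵖ
        (Submodule.span (Quaternion ℝ)ᵐᵒᵖ (generalizedEigenvectors T z)) =
      Module.rank ℂ (Module.End.maxGenEigenspace (complexify T) z) := by
  have hcomm : ∀ q : Quaternion ℝ, (z : Quaternion ℝ) * q = q * (z : Quaternion ℝ) := by
    intro q
    have hz' : (z : Quaternion ℝ) = ((z.re : ℝ) : Quaternion ℝ) := by
      ext <;> simp [hz]
    rw [hz', Quaternion.coe_commutes]
  have heq : (Submodule.span (Quaternion ℝ)ᵐᵒᵖ (generalizedEigenvectors T z)).restrictScalars ℂ =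
      Module.End.maxGenEigenspace (complexify T) z := by
    refine le_antisymm (fun v hv => ?_) fun v hv => ?_
    · refine Submodule.span_induction (p := fun v _ =>
        v ∈ Module.End.maxGenEigenspace (complexify T) z) (fun x hx => ?_) (Submodule.zero_mem _)
        (fun x y _ _ => Submodule.add_mem _) (fun q x _ hx => ?_) hv
      · rwa [generalizedEigenvectors_eq] at hx
      · exact mem_maxGenEigenspace_op_smul T (hcomm q.unop) hx
    · refine Submodule.subset_span ?_
      rwa [generalizedEigenvectors_eq]
  rw [← rank_restrictScalars_complex, heq]

end QuaternionicOperator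

end

noncomputable section

/-! ### Weyl's inequality for standard eigenvalues. -/

namespace QuaternionicOperator

section Weyl

open Module QuaternionicInnerProductSpace

attribute [local instance] quaternionOpComplexModule complexInnerProductSpace isScalarTower_complex

variable {E : Type*} [NormedAddCommGroup E] [Module (Quaternion ℝ)ᵐᵒᵖ E]
  [QuaternionicInnerProductSpace E] {T : E →L[(Quaternion ℝ)ᵐᵒᵖ] E} {p : ℝ}

theorem finiteDimensional_maxGenEigenspace_complexify (hp : 1 ≤ p)
    (hT : Summable fun n : ℕ => singularValue T n ^ p) {z : ℂ} (hz : z ≠ 0) :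
    FiniteDimensional ℂ (Module.End.maxGenEigenspace (complexify T) z) :=
  (approximationNumbersLE_complexify T).finiteDimensional_maxGenEigenspace hp
    (sum_range_singularValue_half_le T hT) hz

theorem multiplicity_le_finrank (hp : 1 ≤ p) (hT : Summable fun n : ℕ => singularValue T n ^ p)
    {z : ℂ} (hz : z ≠ 0) :
    multiplicity T z ≤ finrank ℂ (Module.End.maxGenEigenspace (complexify T) z) := by
  have := finiteDimensional_maxGenEigenspace_complexify hp hT hz
  have h := OrderHomClass.mono Cardinal.toENat (rank_span_generalizedEigenvectors_le T z)
  rwa [Cardinal.toENat_nat] at h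

theorem multiplicity_ne_top (hp : 1 ≤ p) (hT : Summable fun n : ℕ => singularValue T n ^ p)
    {z : ℂ} (hz : z ≠ 0) : multiplicity T z ≠ ⊤ :=
  ((multiplicity_le_finrank hp hT hz).trans_lt (ENat.natCast_lt_top _)).ne

theorem two_mul_toNat_multiplicity_le (hp : 1 ≤ p)
    (hT : Summable fun n : ℕ => singularValue T n ^ p) {z : ℂ} (hz : z ≠ 0) :
    2 * (multiplicity T z).toNat ≤ finrank ℂ (Module.End.maxGenEigenspace (complexify T) z) +
      if z.im = 0 then 0
      else finrank ℂ (Module.End.maxGenEigenspace (complexify T) (starRingEnd ℂ z)) := by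
  split_ifs with him
  · have h := congrArg Cardinal.toNat (two_mul_rank_span_generalizedEigenvectors T him)
    rw [Cardinal.toNat_mul] at h
    simp only [Cardinal.toNat_ofNat] at h
    exact h.le
  · have h := ENat.toNat_le_of_le_natCast (multiplicity_le_finrank hp hT hz)
    rw [finrank_maxGenEigenspace_conj]
    omega

theorem sum_toNat_multiplicity_mul_rpow_le (hp : 1 ≤ p)
    (hT : Summable fun n : ℕ => singularValue T n ^ p) (Z : Finset ℂ)
    (hZ : ∀ z ∈ Z, z ≠ 0 ∧ 0 ≤ z.im) :
    ∑ z ∈ Z, ((multiplicity T z).toNat : ℝ) * ‖z‖ ^ p ≤ ∑' n, singularValue T n ^ p := by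
  -- Only nonreal points are reflected: a real eigenvalue already has doubled complex multiplicity.
  -- As `Z` lies in the closed upper half-plane, `N` is disjoint from it.
  let N : Finset ℂ := (Z.filter fun z => z.im ≠ 0).image (starRingEnd ℂ)
  have hN : ∀ z ∈ N, z ≠ 0 ∧ z.im < 0 := by
    intro z hz
    obtain ⟨w, hw, rfl⟩ := Finset.mem_image.1 hz
    obtain ⟨hwZ, hwim⟩ := Finset.mem_filter.1 hw
    obtain ⟨hw0, hw1⟩ := hZ w hwZ
    refine ⟨by simpa using hw0, ?_⟩
    rw [Complex.conj_im, neg_lt_zero]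
    exact lt_of_le_of_ne hw1 hwim.symm
  have hdisj : Disjoint Z N := Finset.disjoint_left.2 fun z hz hz' =>
    absurd (hZ z hz).2 (not_le.2 (hN z hz').2)
  have h0 : (0 : ℂ) ∉ Z ∪ N := by
    intro h
    rcases Finset.mem_union.1 h with h | h
    · exact (hZ 0 h).1 rfl
    · exact (hN 0 h).1 rfl
  have hweyl := (approximationNumbersLE_complexify T).sum_finrank_mul_rpow_le hp
    (sum_range_singularValue_half_le T hT) (Z ∪ N) h0
  rw [Finset.sum_union hdisj, Finset.sum_image fun _ _ _ _ h => (starRingEnd ℂ).injective h,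
    Finset.sum_filter, ← Finset.sum_add_distrib] at hweyl
  have hle : 2 * ∑ z ∈ Z, ((multiplicity T z).toNat : ℝ) * ‖z‖ ^ p ≤
      2 * ∑' n, singularValue T n ^ p := by
    refine le_trans ?_ hweyl
    rw [Finset.mul_sum]
    refine Finset.sum_le_sum fun z hz => ?_
    have h := two_mul_toNat_multiplicity_le hp hT (hZ z hz).1
    have hz0 : 0 ≤ ‖z‖ ^ p := by positivity
    have h' := mul_le_mul_of_nonneg_right ((Nat.cast_le (α := ℝ)).2 h) hz0
    push_cast at h'
    rw [← mul_assoc]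
    refine h'.trans (le_of_eq ?_)
    by_cases him : z.im = 0
    · simp [him]
    · simp [him, add_mul]
  linarith

theorem one_le_toNat_multiplicity (hp : 1 ≤ p)
    (hT : Summable fun n : ℕ => singularValue T n ^ p) {z : ℂ} (hz : z ≠ 0)
    (hzT : IsStandardEigenvalue T z) : 1 ≤ (multiplicity T z).toNat := by
  obtain ⟨_, v, hv, hTv⟩ := hzT
  rw [Nat.one_le_iff_ne_zero]
  intro h
  have h0 : multiplicity T z = 0 :=
    (ENat.toNat_eq_zero.1 h).resolve_right (multiplicity_ne_top hp hT hz)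
  rw [multiplicity, Cardinal.toENat_eq_zero, Submodule.rank_eq_zero, Submodule.span_eq_bot] at h0
  exact hv (h0 v ⟨1, by simp [hTv]⟩)

/-- Each multiplicity is at least 1, so the strictly positive family `‖z‖ ^ p` is summable and its
index set countable. -/
theorem countable_standardEigenvalues (hp : 1 ≤ p)
    (hT : Summable fun n : ℕ => singularValue T n ^ p) :
    {z : ℂ | z ≠ 0 ∧ IsStandardEigenvalue T z}.Countable := by
  have hsum : Summable fun z : {z : ℂ | z ≠ 0 ∧ IsStandardEigenvalue T z} => ‖(z : ℂ)‖ ^ p := by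
    refine summable_of_sum_le (fun z => by positivity) (c := ∑' n, singularValue T n ^ p)
      fun u => ?_
    refine le_trans ?_ (sum_toNat_multiplicity_mul_rpow_le hp hT
      (u.map (Function.Embedding.subtype _)) ?_)
    · rw [Finset.sum_map]
      refine Finset.sum_le_sum fun z _ => le_mul_of_one_le_left (by positivity) ?_
      exact_mod_cast one_le_toNat_multiplicity hp hT z.2.1 z.2.2
    · intro z hz
      obtain ⟨w, _, rfl⟩ := Finset.mem_map.1 hz
      exact ⟨w.2.1, w.2.2.1⟩
  have h := hsum.countable_support
  rw [Set.eq_univ_of_forall (s := Function.support _) fun z =>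
    (Real.rpow_pos_of_pos (norm_pos_iff.2 z.2.1) p).ne'] at h
  exact Set.countable_coe_iff.1 (Set.countable_univ_iff.1 h)

theorem exists_isStandardEigenvalueSequence (hp : 1 ≤ p)
    (hT : Summable fun n : ℕ => singularValue T n ^ p) :
    ∃ l : ℕ → ℂ, IsStandardEigenvalueSequence T l := by
  let Z := {z : ℂ | z ≠ 0 ∧ IsStandardEigenvalue T z}
  have : Countable Z := (countable_standardEigenvalues hp hT).to_subtype
  -- One index per eigenvalue and copy; positions of `ℕ` outside the image of `f` are filled with
  -- zeros.
  let I := Σ z : Z, Fin (multiplicity T z).toNat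
  obtain ⟨f, hf⟩ := exists_injective_nat I
  let l : ℕ → ℂ := Function.extend f (fun i => (i.1 : ℂ)) 0
  have hl : ∀ i, l (f i) = i.1 := fun i => hf.extend_apply _ _ i
  have hl0 : ∀ k, k ∉ Set.range f → l k = 0 := fun k hk =>
    Function.extend_apply' _ _ _ hk
  refine ⟨l, fun k => ?_, fun z hz hzT => ?_⟩
  · by_cases hk : k ∈ Set.range f
    · obtain ⟨i, rfl⟩ := hk
      right
      rw [hl]
      exact i.1.2.2
    · exact Or.inl (hl0 k hk)
  · let ζ : Z := ⟨z, hz, hzT⟩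
    have hset : {k : ℕ | l k = z} =
        Set.range fun i : Fin (multiplicity T ζ).toNat => f ⟨ζ, i⟩ := by
      ext k
      constructor
      · intro hk
        by_cases hkf : k ∈ Set.range f
        · obtain ⟨⟨w, i⟩, rfl⟩ := hkf
          have hw : w = ζ := Subtype.ext ((hl _).symm.trans hk)
          subst hw
          exact ⟨i, rfl⟩
        · exact absurd ((hl0 k hkf).symm.trans hk) hz.symm
      · rintro ⟨i, rfl⟩
        exact hl _
    have hinj : Function.Injective fun i : Fin (multiplicity T ζ).toNat => f ⟨ζ, i⟩ :=
      fun i j h => eq_of_heq (Sigma.mk.inj (hf h)).2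
    rw [hset, ← Set.image_univ, hinj.encard_image, Set.encard_univ, ENat.card_eq_coe_fintype_card,
      Fintype.card_fin]
    exact ENat.natCast_toNat (multiplicity_ne_top hp hT hz)

theorem IsStandardEigenvalueSequence.sum_rpow_le (hp : 1 ≤ p)
    (hT : Summable fun n : ℕ => singularValue T n ^ p) {l : ℕ → ℂ}
    (hl : IsStandardEigenvalueSequence T l) (K : Finset ℕ) :
    ∑ k ∈ K, ‖l k‖ ^ p ≤ ∑' n, singularValue T n ^ p := by
  let Z : Finset ℂ := (K.image l).filter fun z => z ≠ 0
  have hZ : ∀ z ∈ Z, z ≠ 0 ∧ IsStandardEigenvalue T z := by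
    intro z hz
    obtain ⟨hzK, hz0⟩ := Finset.mem_filter.1 hz
    obtain ⟨k, _, rfl⟩ := Finset.mem_image.1 hzK
    exact ⟨hz0, (hl.1 k).resolve_left hz0⟩
  refine le_trans ?_ (sum_toNat_multiplicity_mul_rpow_le hp hT Z
    fun z hz => ⟨(hZ z hz).1, (hZ z hz).2.1⟩)
  rw [← Finset.sum_fiberwise_of_maps_to (t := K.image l) (g := l)
    fun k hk => Finset.mem_image_of_mem l hk]
  rw [Finset.sum_filter]
  refine Finset.sum_le_sum fun z hz => ?_
  rw [Finset.sum_congr rfl (g := fun _ => ‖z‖ ^ p) fun k hk => by rw [(Finset.mem_filter.1 hk).2],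
    Finset.sum_const, nsmul_eq_mul]
  split_ifs with hz0
  · refine mul_le_mul_of_nonneg_right ?_ (by positivity)
    have hzT := (hZ z (Finset.mem_filter.2 ⟨hz, hz0⟩)).2
    have h1 : ((K.filter fun k => l k = z).card : ℕ∞) ≤ multiplicity T z := by
      rw [← hl.2 z hz0 hzT, ← Set.encard_coe_eq_coe_finsetCard]
      exact Set.encard_le_encard fun k hk => (Finset.mem_filter.1 hk).2
    have h2 := ENat.toNat_le_toNat h1 (multiplicity_ne_top hp hT hz0)
    rw [ENat.toNat_natCast] at h2
    exact_mod_cast h2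
  · rw [not_not.1 hz0, norm_zero, Real.zero_rpow (by linarith), mul_zero]

end Weyl

end QuaternionicOperator

end

theorem mainTheorem8 {H : Type*} [NormedAddCommGroup H] [Module (Quaternion ℝ)ᵐᵒᵖ H]
    [QuaternionicInnerProductSpace H] [CompleteSpace H] (p : ℝ) (hp : 1 ≤ p)
    (T : H →L[(Quaternion ℝ)ᵐᵒᵖ] H) (hT : QuaternionicOperator.IsSchatten p T) :
    (∃ l : ℕ → ℂ, QuaternionicOperator.IsStandardEigenvalueSequence T l) ∧
      ∀ l : ℕ → ℂ, QuaternionicOperator.IsStandardEigenvalueSequence T l →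
        (Summable fun k : ℕ => ‖l k‖ ^ p) ∧
          (∑' k : ℕ, ‖l k‖ ^ p) ^ (1 / p) ≤ QuaternionicOperator.schattenNorm p T := by
  refine ⟨QuaternionicOperator.exists_isStandardEigenvalueSequence hp hT.2, fun l hl => ?_⟩
  have hsum : Summable fun k : ℕ => ‖l k‖ ^ p :=
    summable_of_sum_le (fun k => by positivity) (hl.sum_rpow_le hp hT.2)
  refine ⟨hsum, ?_⟩
  exact Real.rpow_le_rpow (tsum_nonneg fun k => by positivity)
    (hsum.tsum_le_of_sum_le (hl.sum_rpow_le hp hT.2)) (by positivity)
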